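/- Let $\mathbb{D}$ be the open unit disk and $\mathbb{H}=\{w:\operatorname{Re}w>0\}$. A self-map of $\mathbb{D}$ is a holomorphic $f:\mathbb{D}\to\mathbb{D}$; $f_n$ denotes its $n$-th iterate. The Denjoy–Wolff point of a non-identity self-map $f$ is its fixed point in $\mathbb{D}$ if there is one, and otherwise the point of $\partial\mathbb{D}$ to which the iterates of $f$ converge uniformly on compact subsets of $\mathbb{D}$. The map $f$ is called hyperbolic (respectively parabolic) if its Denjoy–Wolff point $p$ lies on $\partial\mathbb{D}$ and the angular derivative satisfies $f'(p)<1$ (respectively $f'(p)=1$). For $|\tau|=1$ put $T_\tau(z)=\frac{\tau+z}{\tau-z}$, which maps $\mathbb{D}$ conformally onto $\mathbb{H}$. Theorem. Let $\varphi$ be a linear fractional self-map of $\mathbb{D}$ (that is, $\varphi(z)=\frac{az+b}{cz+d}$ with $ad-bc\neq0$ and $\varphi(\mathbb{D})\subset\mathbb{D}$) which is parabolic or hyperbolic, and let $n\ge1$ be an integer. Then there is exactly one self-map $f$ of $\mathbb{D}$ with $f_n=\varphi$. This $f$ is parabolic if $\varphi$ is parabolic, and hyperbolic if $\varphi$ is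 hyperbolic. Moreover, if $\tau$ is the Denjoy–Wolff point of $\varphi$, then there are $A\ge1$ and $B\in\mathbb{C}$ with $\operatorname{Re}B\ge0$ such that $$T_\tau\circ\varphi\circ T_\tau^{-1}(w)=Aw+B\qquad(w\in\mathbb{H}),$$ and, if $\alpha$ denotes the unique positive $n$-th root of $A$ and $$g(w)=\alpha w+\frac{B}{\sum_{k=0}^{n-1}\alpha^k},$$ then for all $z\in\mathbb{D}$ $$f(z)=T_\tau^{-1}\bigl(g(T_\tau(z))\bigr)=\tau\,\frac{g\left(\frac{\tau+z}{\tau-z}\right)-1}{g\left(\frac{\tau+z}{\tau-z}\right)+1}.$$ -/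

import Mathlib

open Set Filter Topology

namespace DiskMaps

/-- The open unit disk. -/
def disk : Set ℂ := Metric.ball (0 : ℂ) 1

/-- `f` is a (holomorphic) self-map of the unit disk. Only the values of `f` on the disk matter. -/
def IsSelfMap (f : ℂ → ℂ) : Prop :=
  DifferentiableOn ℂ f disk ∧ MapsTo f disk disk

/-- On the disk, `f` is given by a linear fractional transformation without pole there. -/
def IsLFT (f : ℂ → ℂ) : Prop :=
  ∃ a b c d : ℂ, a * d - b * c ≠ 0 ∧
    ∀ z ∈ disk, c * z + d ≠ 0 ∧ f z = (a * z + b) / (c * z + d)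

/-- The Stolz (non-tangential approach) region of aperture `M` at the boundary point `p`. -/
def stolz (p : ℂ) (M : ℝ) : Set ℂ :=
  {z | z ∈ disk ∧ ‖z - p‖ < M * (1 - ‖z‖)}

/-- `f` has angular (non-tangential) limit `q` at the boundary point `p`. -/
def HasAngularLimit (f : ℂ → ℂ) (p q : ℂ) : Prop :=
  ∀ M : ℝ, 1 < M → Tendsto f (𝓝[stolz p M] p) (𝓝 q)

/-- `f` has the (finite) angular derivative `c` at the boundary point `p`: the angular limit `q`
of `f` at `p` lies on the unit circle and `(f z - q) / (z - p)` has angular limit `c` at `p`. -/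
def HasAngularDeriv (f : ℂ → ℂ) (p c : ℂ) : Prop :=
  ∃ q : ℂ, ‖q‖ = 1 ∧ HasAngularLimit f p q ∧
    HasAngularLimit (fun z => (f z - q) / (z - p)) p c

/-- `p` is the Denjoy-Wolff point of the self-map `f` of the disk, `f` not the identity: either
the fixed point of `f` in the disk or, if there is none, the point of the unit circle to which
the iterates of `f` converge uniformly on the compact subsets of the disk. -/
def IsDenjoyWolffPoint (f : ℂ → ℂ) (p : ℂ) : Prop :=
  ¬ EqOn f id disk ∧
    ((p ∈ disk ∧ f p = p) ∨
      (‖p‖ = 1 ∧ (∀ z ∈ disk, f z ≠ z) ∧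
        ∀ K : Set ℂ, K ⊆ disk → IsCompact K →
          TendstoUniformlyOn (fun k : ℕ => f^[k]) (fun _ => p) atTop K))

/-- Hyperbolic: the Denjoy-Wolff point is on the unit circle, with angular derivative `< 1`. -/
def IsHyperbolic (f : ℂ → ℂ) : Prop :=
  ∃ p : ℂ, ‖p‖ = 1 ∧ IsDenjoyWolffPoint f p ∧ ∃ c : ℝ, c < 1 ∧ HasAngularDeriv f p (c : ℂ)

/-- Parabolic: the Denjoy-Wolff point is on the unit circle, with angular derivative `1`. -/
def IsParabolic (f : ℂ → ℂ) : Prop :=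
  ∃ p : ℂ, ‖p‖ = 1 ∧ IsDenjoyWolffPoint f p ∧ HasAngularDeriv f p 1

/-- `f` is a self-map of the disk that solves `f_n = φ` there (`f_n` is the `n`-th iterate). -/
def IsRoot (n : ℕ) (φ f : ℂ → ℂ) : Prop :=
  IsSelfMap f ∧ EqOn (f^[n]) φ disk

/-- The Cayley transform of the disk onto the right half-plane that takes `τ` to infinity. -/
noncomputable def cayley (τ z : ℂ) : ℂ := (τ + z) / (τ - z)

/-- The inverse of the Cayley transform, defined on the right half-plane. -/
noncomputable def cayleyInv (τ w : ℂ) : ℂ := τ * ((w - 1) / (w + 1))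

theorem cayleyInv_cayley {τ z : ℂ} (hτ : ‖τ‖ = 1) (hz : z ∈ disk) :
    cayleyInv τ (cayley τ z) = z := by
  have h0 : τ ≠ 0 := by
    rintro rfl
    simp at hτ
  have h1 : τ - z ≠ 0 := by
    intro h
    have : τ = z := sub_eq_zero.mp h
    subst this
    simp [disk, hτ] at hz
  unfold cayleyInv cayley
  have e1 : (τ + z) / (τ - z) - 1 = 2 * z / (τ - z) := by field_simp; ring
  have e2 : (τ + z) / (τ - z) + 1 = 2 * τ / (τ - z) := by field_simp; ring
  rw [e1, e2]
  field_simp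

theorem cayley_cayleyInv {τ w : ℂ} (hτ : ‖τ‖ = 1) (hw : 0 < w.re) :
    cayley τ (cayleyInv τ w) = w := by
  have h0 : τ ≠ 0 := by
    rintro rfl
    simp at hτ
  have h1 : w + 1 ≠ 0 := by
    intro h
    have := congrArg Complex.re h
    simp at this
    linarith
  unfold cayleyInv cayley
  have e1 : τ + τ * ((w - 1) / (w + 1)) = 2 * τ * w / (w + 1) := by field_simp; ring
  have e2 : τ - τ * ((w - 1) / (w + 1)) = 2 * τ / (w + 1) := by field_simp; ring
  rw [e1, e2]
  field_simp

end DiskMaps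

/-! The Cayley transform at the Denjoy-Wolff point turns `φ` into `G w = A w + B` on the half-plane,
with `A ≥ 1`, `Re B ≥ 0`, `(A, B) ≠ (1, 0)` (`exists_affine_conj`). An affine root is easy to write
down; the substance is uniqueness, that is, that every holomorphic root `H` of `G` is affine
(`exists_affine_of_root`).

`H` commutes with `G = H^n`, so it extends to `E = G⁻ᵏ ∘ H ∘ Gᵏ` on the union of the preimages of
the half-plane under `Gᵏ`. If `A = 1` and `Re B > 0`, this union is the plane and `Re E` is at least
`-(|w| + C)`; a Liouville argument makes `E` affine. Otherwise it is a half-plane of which `G` is an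
automorphism; then `E` is one too, hence Möbius by the Schwarz lemma, and it fixes infinity because
it commutes with `G`, whose orbits escape there.

An affine root has real slope `p ≥ 0` with `p^n = A`, which leaves one choice. The conjugate of `a w
+ b` has angular derivative `1 / a`, so the type passes from `φ` to `f`. -/

namespace DiskMaps

/-! ### Affine self-maps of the half-plane. -/

/-- The open right half-plane. -/
def rhp : Set ℂ := {w : ℂ | 0 < w.re}

theorem isOpen_rhp : IsOpen rhp := isOpen_lt continuous_const Complex.continuous_re

theorem im_eq_zero_of_affine_mapsTo {a b : ℂ} (h : ∀ w : ℂ, 0 < w.re → 0 < (a * w + b).re) :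
    a.im = 0 ∧ 0 ≤ a.re ∧ 0 ≤ b.re := by
  have key : ∀ x y : ℝ, 0 < x → 0 < a.re * x - a.im * y + b.re := by
    intro x y hx
    have := h ⟨x, y⟩ hx
    simpa using this
  refine ⟨?_, ?_, ?_⟩
  · by_contra h0
    -- This ordinate makes the real part of the image exactly zero.
    have := key 1 ((a.re + b.re) / a.im) one_pos
    rw [mul_div_cancel₀ _ h0] at this
    linarith
  · by_contra! h0
    have h1 : 0 < |b.re| / (-a.re) + 1 := by
      have : 0 < -a.re := by linarith
      positivity
    have := key _ 0 h1
    have h2 : a.re * (|b.re| / (-a.re) + 1) = -|b.re| + a.re := by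
      have : a.re ≠ 0 := h0.ne
      field_simp
    rw [h2] at this
    linarith [le_abs_self b.re]
  · by_contra! h0
    have h1 := key 1 0 one_pos
    have ha : 0 < a.re := by linarith
    have h2 := key (-b.re / a.re) 0 (div_pos (by linarith) ha)
    rw [mul_div_cancel₀ _ ha.ne'] at h2
    linarith

theorem affine_iterate (a b w : ℂ) (k : ℕ) :
    (fun w => a * w + b)^[k] w = a ^ k * w + b * ∑ j ∈ Finset.range k, a ^ j := by
  induction k with
  | zero => simp
  | succ k ih =>
    rw [Function.iterate_succ_apply', ih, Finset.sum_range_succ']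
    simp only [pow_succ]
    rw [← Finset.sum_mul]
    ring

theorem affine_mapsTo_rhp {a : ℝ} {b : ℂ} (ha : 0 < a) (hb : 0 ≤ b.re) :
    MapsTo (fun w : ℂ => (a : ℂ) * w + b) rhp rhp := by
  intro w hw
  have hw' : 0 < w.re := hw
  have : 0 < a * w.re := mul_pos ha hw'
  change 0 < ((a : ℂ) * w + b).re
  simp only [Complex.add_re, Complex.re_ofReal_mul]
  linarith

/-- For `a = 1` the iterates are translations by `k * b`; for `a > 1` real parts grow at least like
`a ^ k` times their minimum over `K`. -/
theorem affine_iterate_tendsto {a : ℝ} {b : ℂ} (ha : 1 ≤ a) (hb : 0 ≤ b.re)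
    (hab : a = 1 → b ≠ 0) {K : Set ℂ} (hK : K ⊆ rhp) (hKc : IsCompact K) (R : ℝ) :
    ∀ᶠ k : ℕ in atTop, ∀ w ∈ K, R ≤ ‖(fun w : ℂ => (a : ℂ) * w + b)^[k] w‖ := by
  rcases K.eq_empty_or_nonempty with rfl | hne
  · simp
  rcases ha.eq_or_lt with h1 | h1
  · subst h1
    obtain ⟨M, hM⟩ := hKc.isBounded.exists_norm_le
    have hb0 : 0 < ‖b‖ := norm_pos_iff.mpr (hab rfl)
    have : Tendsto (fun k : ℕ => (k : ℝ) * ‖b‖) atTop atTop :=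
      tendsto_natCast_atTop_atTop.atTop_mul_const hb0
    filter_upwards [this.eventually_ge_atTop (R + M)] with k hk w hw
    rw [affine_iterate]
    simp only [Complex.ofReal_one, one_pow, one_mul, Finset.sum_const, Finset.card_range,
      nsmul_eq_mul, mul_one]
    have h2 : ‖b * (k : ℂ)‖ ≤ ‖w + b * k‖ + ‖w‖ := by
      have := norm_sub_le (w + b * k) w
      simpa using this
    rw [norm_mul, Complex.norm_natCast] at h2
    have := hM w hw
    linarith [mul_comm ‖b‖ (k : ℝ)]
  · obtain ⟨w₀, hw₀, hmin⟩ := hKc.exists_isMinOn hne Complex.continuous_re.continuousOn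
    have hpos : 0 < w₀.re := hK hw₀
    have : Tendsto (fun k : ℕ => a ^ k * w₀.re) atTop atTop :=
      (tendsto_pow_atTop_atTop_of_one_lt h1).atTop_mul_const hpos
    filter_upwards [this.eventually_ge_atTop R] with k hk w hw
    refine le_trans ?_ (Complex.re_le_norm _)
    rw [affine_iterate]
    have e : (∑ j ∈ Finset.range k, (a : ℂ) ^ j) = ((∑ j ∈ Finset.range k, a ^ j : ℝ) : ℂ) := by
      push_cast; rfl
    rw [e, ← Complex.ofReal_pow, Complex.add_re, Complex.re_ofReal_mul, Complex.re_mul_ofReal]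
    have h3 : a ^ k * w₀.re ≤ a ^ k * w.re :=
      mul_le_mul_of_nonneg_left (hmin hw) (by positivity)
    have h4 : 0 ≤ b.re * ∑ j ∈ Finset.range k, a ^ j :=
      mul_nonneg hb (Finset.sum_nonneg fun _ _ => by positivity)
    linarith

/-! ### The Cayley transform between disk and half-plane. -/

theorem one_add_ne_zero_of_mem_rhp {w : ℂ} (hw : w ∈ rhp) : w + 1 ≠ 0 := by
  intro h
  have h1 := congrArg Complex.re h
  have : 0 < w.re := hw
  simp at h1
  linarith

theorem sub_ne_zero_of_mem_disk {τ z : ℂ} (hτ : ‖τ‖ = 1) (hz : z ∈ disk) : τ - z ≠ 0 := by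
  intro h
  rw [sub_eq_zero] at h
  subst h
  simp [disk, hτ] at hz

theorem cayley_mem_rhp {τ z : ℂ} (hτ : ‖τ‖ = 1) (hz : z ∈ disk) : cayley τ z ∈ rhp := by
  have h1 := sub_ne_zero_of_mem_disk hτ hz
  have hz' : ‖z‖ < 1 := by simpa [disk] using hz
  have h2 : 0 < Complex.normSq (τ - z) := Complex.normSq_pos.mpr h1
  change 0 < ((τ + z) / (τ - z)).re
  rw [Complex.div_re, ← add_div]
  refine div_pos ?_ h2
  have e1 : τ.re * τ.re + τ.im * τ.im = 1 := by
    rw [← Complex.normSq_apply, Complex.normSq_eq_norm_sq, hτ, one_pow]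
  have e2 : z.re * z.re + z.im * z.im < 1 := by
    rw [← Complex.normSq_apply, Complex.normSq_eq_norm_sq]
    nlinarith [norm_nonneg z]
  simp only [Complex.add_re, Complex.sub_re, Complex.add_im, Complex.sub_im]
  nlinarith

theorem cayleyInv_mem_disk {τ w : ℂ} (hτ : ‖τ‖ = 1) (hw : w ∈ rhp) : cayleyInv τ w ∈ disk := by
  have h1 := one_add_ne_zero_of_mem_rhp hw
  have hw' : 0 < w.re := hw
  simp only [disk, Metric.mem_ball, dist_zero_right, cayleyInv, norm_mul, hτ, one_mul, norm_div]
  rw [div_lt_one (norm_pos_iff.mpr h1), ← abs_of_nonneg (norm_nonneg (w - 1)),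
    ← abs_of_nonneg (norm_nonneg (w + 1)), ← sq_lt_sq, ← Complex.normSq_eq_norm_sq,
    ← Complex.normSq_eq_norm_sq, Complex.normSq_apply, Complex.normSq_apply]
  simp
  nlinarith

theorem differentiableOn_cayley {τ : ℂ} (hτ : ‖τ‖ = 1) : DifferentiableOn ℂ (cayley τ) disk := by
  unfold cayley
  refine DifferentiableOn.div (by fun_prop) (by fun_prop) fun z hz => ?_
  exact sub_ne_zero_of_mem_disk hτ hz

theorem differentiableOn_cayleyInv (τ : ℂ) : DifferentiableOn ℂ (cayleyInv τ) rhp := by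
  unfold cayleyInv
  refine DifferentiableOn.const_mul ?_ _
  exact DifferentiableOn.div (by fun_prop) (by fun_prop) fun z hz => one_add_ne_zero_of_mem_rhp hz

/-! ### Rigidity: holomorphic roots of affine maps are affine. -/

/-- The Schwarz lemma for an automorphism of the half-plane that fixes `1`. -/
theorem exists_rotation_of_leftInverse {K L : ℂ → ℂ} (hK : DifferentiableOn ℂ K rhp)
    (hKm : MapsTo K rhp rhp) (hL : DifferentiableOn ℂ L rhp) (hLm : MapsTo L rhp rhp)
    (hLK : ∀ w ∈ rhp, L (K w) = w) (hK1 : K 1 = 1) :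
    ∃ c : ℂ, ‖c‖ = 1 ∧ ∀ w ∈ rhp, (K w - 1) * (w + 1) = c * (w - 1) * (K w + 1) := by
  have h1 : ‖(1 : ℂ)‖ = 1 := norm_one
  have one_mem : (1 : ℂ) ∈ rhp := by simp [rhp]
  have hc : MapsTo (cayley 1) disk rhp := fun z hz => cayley_mem_rhp h1 hz
  have hci : MapsTo (cayleyInv 1) rhp disk := fun w hw => cayleyInv_mem_disk h1 hw
  have conj : ∀ {M : ℂ → ℂ}, DifferentiableOn ℂ M rhp → MapsTo M rhp rhp → M 1 = 1 →
      DifferentiableOn ℂ (fun z => cayleyInv 1 (M (cayley 1 z))) disk ∧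
      MapsTo (fun z => cayleyInv 1 (M (cayley 1 z))) disk disk ∧
      cayleyInv 1 (M (cayley 1 0)) = 0 := by
    intro M hM hMm hM1
    refine ⟨?_, fun z hz => hci (hMm (hc hz)), ?_⟩
    · exact (differentiableOn_cayleyInv 1).comp (hM.comp (differentiableOn_cayley h1) hc)
        (hMm.comp hc)
    · have : cayley 1 0 = 1 := by simp [cayley]
      rw [this, hM1]; simp [cayleyInv]
  have hL1 : L 1 = 1 := by have := hLK 1 one_mem; rwa [hK1] at this
  obtain ⟨dF, mF, F0⟩ := conj hK hKm hK1
  obtain ⟨dE, mE, E0⟩ := conj hL hLm hL1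
  set F : ℂ → ℂ := fun z => cayleyInv 1 (K (cayley 1 z)) with hF
  set E : ℂ → ℂ := fun z => cayleyInv 1 (L (cayley 1 z)) with hE
  have F0' : F 0 = 0 := F0
  have hEF : ∀ z ∈ disk, E (F z) = z := by
    intro z hz
    simp only [hE, hF]
    rw [cayley_cayleyInv h1 (hKm (hc hz)), hLK _ (hc hz), cayleyInv_cayley h1 hz]
  have mF' : MapsTo F (Metric.ball 0 1) (Metric.closedBall 0 1) :=
    mF.mono_right Metric.ball_subset_closedBall
  -- The Schwarz lemma for `F` and for its left inverse `E` gives the two inequalities; equality at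
  -- one point, here `1 / 2`, then makes `F` a rotation.
  have hnorm : ∀ z ∈ disk, ‖F z‖ = ‖z‖ := by
    intro z hz
    apply le_antisymm
    · exact Complex.norm_le_norm_of_mapsTo_ball dF mF' F0' (by simpa [disk] using hz)
    · have hz' : ‖F z‖ < 1 := by simpa [disk] using mF hz
      have := Complex.norm_le_norm_of_mapsTo_ball dE
        (mE.mono_right Metric.ball_subset_closedBall) E0 hz'
      rwa [hEF z hz] at this
  have hhalf : (1 / 2 : ℂ) ∈ disk := by simp [disk]; norm_num
  obtain ⟨c, hc1, hcF⟩ := Complex.affine_of_mapsTo_ball_of_exists_norm_dslope_eq_div'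
    (f := F) (c := 0) (R₁ := 1) (R₂ := 1) dF (by rw [F0']; exact mF')
    ⟨1 / 2, hhalf, by
      rw [dslope_of_ne _ (by norm_num), slope_def_module, F0', sub_zero, sub_zero, norm_smul,
        hnorm _ hhalf]
      norm_num⟩
  refine ⟨c, by simpa using hc1, fun w hw => ?_⟩
  have h2 := hcF (hci hw)
  simp only [F0', zero_add, sub_zero, smul_eq_mul] at h2
  simp only [hF] at h2
  rw [cayley_cayleyInv h1 hw] at h2
  have n1 := one_add_ne_zero_of_mem_rhp hw
  have n2 := one_add_ne_zero_of_mem_rhp (hKm hw)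
  simp only [cayleyInv, one_mul] at h2
  field_simp at h2
  linear_combination h2

/-- Borel-Carathéodory upgrades the one-sided bound to linear growth of `F`; Cauchy's estimate then
bounds `F'`, which is constant by Liouville. -/
theorem affine_of_re_ge {F : ℂ → ℂ} (hF : Differentiable ℂ F) {C : ℝ}
    (h : ∀ w, -(‖w‖ + C) ≤ (F w).re) : ∃ a b : ℂ, ∀ w, F w = a * w + b := by
  set C' := |C| + 1
  have hC' : 1 ≤ C' := by simp [C']
  have hCC : C ≤ C' := by have := le_abs_self C; simp only [C']; linarith
  have hC0 : 0 < C' := by linarith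
  set D : ℝ := 6 + 2 * C' + 3 * ‖F 0‖
  have bound : ∀ w : ℂ, ‖F w‖ ≤ D * (‖w‖ + 1) := by
    intro w
    have hw := norm_nonneg w
    have hR : 0 < 2 * (‖w‖ + 1) := by positivity
    have hM : 0 < 2 * (‖w‖ + 1) + C' := by linarith
    have := Complex.borelCaratheodory (f := fun w => -F w) (M := 2 * (‖w‖ + 1) + C')
      (R := 2 * (‖w‖ + 1)) (z := w) hM hF.neg.differentiableOn
      (fun x hx => by
        have h1 := h x
        have h2 : ‖x‖ < 2 * (‖w‖ + 1) := by simpa using hx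
        simp only [mem_ofPred_eq, Complex.neg_re]
        linarith) hR (by simp; linarith)
    simp only [norm_neg] at this
    refine this.trans ?_
    rw [← add_div, div_le_iff₀ (by linarith)]
    simp only [D]
    have := norm_nonneg (F 0)
    nlinarith [mul_nonneg hw hw, mul_nonneg hw this, mul_nonneg hw hC0.le,
      mul_nonneg (mul_nonneg hw hw) this, mul_nonneg (mul_nonneg hw hw) hC0.le,
      mul_nonneg (mul_nonneg hw hw) hw]
  have hD : 0 ≤ D := by positivity
  have hd : Differentiable ℂ (deriv F) := fun z =>
    ((hF.analyticAt z).deriv).differentiableAt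
  have hbdd : ∀ w, ‖deriv F w‖ ≤ 2 * D := by
    intro w
    -- A radius comparable to `‖w‖` lets the linear growth cancel in Cauchy's estimate.
    have hR : 0 < ‖w‖ + 1 := by positivity
    have := Complex.norm_deriv_le_of_forall_mem_sphere_norm_le (f := F) (c := w)
      (C := D * (2 * (‖w‖ + 1))) hR hF.diffContOnCl (fun z hz => by
        refine (bound z).trans ?_
        have h1 : ‖z - w‖ = ‖w‖ + 1 := by simpa [dist_eq_norm] using hz
        have h2 : ‖z‖ ≤ ‖z - w‖ + ‖w‖ := by simpa using norm_add_le (z - w) w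
        gcongr
        linarith)
    refine this.trans (le_of_eq ?_)
    field_simp
  obtain ⟨a, ha⟩ := hd.exists_const_forall_eq_of_bounded
    (isBounded_iff_forall_norm_le.mpr ⟨2 * D, by rintro _ ⟨w, rfl⟩; exact hbdd w⟩)
  refine ⟨a, F 0, fun w => ?_⟩
  have hg : Differentiable ℂ fun w => F w - a * w := by fun_prop
  have := is_const_of_deriv_eq_zero hg (fun x => by
    have h1 : HasDerivAt (fun w => F w - a * w) (a - a * 1) x :=
      HasDerivAt.sub (ha x ▸ (hF x).hasDerivAt) ((hasDerivAt_id x).const_mul a)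
    rw [h1.deriv]; ring) w 0
  simp only [mul_zero, sub_zero] at this
  linear_combination this

/-- Since `b.re = 0`, `G` is an automorphism, and `K^[n - 1] ∘ G⁻¹` is a left inverse of `K`. The
Schwarz lemma applies once `K` is normalised to fix `1`. -/
theorem exists_affine_of_root_of_automorphism {K : ℂ → ℂ} (hK : DifferentiableOn ℂ K rhp)
    (hKm : MapsTo K rhp rhp) {n : ℕ} (hn : 1 ≤ n) {a : ℝ} {b : ℂ} (ha : 1 ≤ a) (hb : b.re = 0)
    (hab : a = 1 → b ≠ 0) (hroot : ∀ w ∈ rhp, K^[n] w = a * w + b) :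
    ∃ p q : ℂ, ∀ w ∈ rhp, K w = p * w + q := by
  have ha0 : 0 < a := by linarith
  have haC : (a : ℂ) ≠ 0 := by exact_mod_cast ha0.ne'
  have one_mem : (1 : ℂ) ∈ rhp := by simp [rhp]
  set G : ℂ → ℂ := fun w => a * w + b with hG
  have hGm : MapsTo G rhp rhp := affine_mapsTo_rhp ha0 hb.ge
  have hcomm : ∀ w ∈ rhp, K (G w) = G (K w) := by
    intro w hw
    have h1 := hroot (K w) (hKm hw)
    rw [← Function.iterate_succ_apply, Function.iterate_succ_apply', hroot w hw] at h1
    exact h1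
  set Gi : ℂ → ℂ := fun w => (w - b) / a with hGi
  have hGim : MapsTo Gi rhp rhp := by
    intro w hw
    have hw' : 0 < w.re := hw
    change 0 < ((w - b) / (a : ℂ)).re
    rw [Complex.div_ofReal_re, Complex.sub_re, hb, sub_zero]
    positivity
  have hGGi : ∀ w, G (Gi w) = w := fun w => by simp only [hG, hGi]; field_simp; ring
  have hGiG : ∀ w, Gi (G w) = w := fun w => by simp only [hG, hGi]; field_simp; ring
  set c : ℂ := K 1 with hc
  have hcre : 0 < c.re := hKm one_mem
  have hcC : (c.re : ℂ) ≠ 0 := by exact_mod_cast hcre.ne'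
  have hdn : ∀ m, DifferentiableOn ℂ K^[m] rhp := by
    intro m
    induction m with
    | zero => exact differentiableOn_id
    | succ m ih => rw [Function.iterate_succ]; exact ih.comp hK hKm
  have hmn : MapsTo K^[n - 1] rhp rhp := hKm.iterate (n - 1)
  set K₁ : ℂ → ℂ := fun w => (K w - (c.im : ℂ) * Complex.I) / c.re with hK₁
  set s : ℂ → ℂ := fun w => c.re * w + (c.im : ℂ) * Complex.I with hs
  have hsm : MapsTo s rhp rhp := affine_mapsTo_rhp hcre (by simp)
  obtain ⟨l, hl1, hl⟩ := exists_rotation_of_leftInverse (K := K₁)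
    (L := fun w => K^[n - 1] (Gi (s w)))
    ((hK.sub_const _).div_const _)
    (by
      intro w hw
      have : 0 < (K w).re := hKm hw
      change 0 < ((K w - (c.im : ℂ) * Complex.I) / (c.re : ℂ)).re
      rw [Complex.div_ofReal_re]
      simp only [Complex.sub_re, Complex.re_ofReal_mul, Complex.I_re, mul_zero, sub_zero]
      positivity)
    ((hdn (n - 1)).comp (t := rhp) (by
      simp only [hGi, hs]
      fun_prop) (hGim.comp hsm))
    (hmn.comp (hGim.comp hsm))
    (by
      intro w hw
      have e1 : s (K₁ w) = K w := by simp only [hs, hK₁]; field_simp; ring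
      simp only [e1]
      have e2 : Gi (K w) = K (Gi w) := by
        rw [← hGiG (K (Gi w)), ← hcomm _ (hGim hw), hGGi]
      rw [e2, ← Function.iterate_succ_apply, Nat.succ_eq_add_one, Nat.sub_add_cancel hn,
        hroot _ (hGim hw)]
      exact hGGi w)
    (by
      simp only [hK₁]
      rw [← hc, div_eq_one_iff_eq hcC]
      nth_rw 1 [← Complex.re_add_im c]
      ring)
  have hKK₁ : ∀ w, K w = c.re * K₁ w + (c.im : ℂ) * Complex.I := by
    intro w; simp only [hK₁]; field_simp; ring
  by_cases h1 : l = 1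
  · refine ⟨c.re, (c.im : ℂ) * Complex.I, fun w hw => ?_⟩
    have := hl w hw
    rw [h1] at this
    rw [hKK₁]
    have : K₁ w = w := by linear_combination this / 2
    rw [this]
  -- For `l ≠ 1` the Möbius map sends infinity to a finite point, so `K` is bounded near infinity.
  -- This contradicts `K (G^[k] 1) = G^[k] (K 1)`, where both orbits escape.
  exfalso
  have hd : 0 < ‖1 - l‖ := norm_pos_iff.mpr (sub_ne_zero.mpr (Ne.symm h1))
  have hbound : ∀ w ∈ rhp, max 1 (4 / ‖1 - l‖) ≤ ‖w‖ → ‖K w‖ ≤ c.re * (8 / ‖1 - l‖) + |c.im| := by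
    intro w hw hwR
    have hw1 : 1 ≤ ‖w‖ := (le_max_left _ _).trans hwR
    have hw2 : 4 ≤ ‖w‖ * ‖1 - l‖ := (div_le_iff₀ hd).mp ((le_max_right _ _).trans hwR)
    have e : K₁ w * ((1 - l) * w + (1 + l)) = (1 + l) * w + (1 - l) := by
      linear_combination hl w hw
    have hnum : ‖(1 + l) * w + (1 - l)‖ ≤ 4 * ‖w‖ := by
      have a1 : ‖1 + l‖ ≤ 2 := (norm_add_le _ _).trans (by rw [norm_one, hl1]; norm_num)
      have a2 : ‖1 - l‖ ≤ 2 := (norm_sub_le _ _).trans (by rw [norm_one, hl1]; norm_num)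
      refine (norm_add_le _ _).trans ?_
      rw [norm_mul]
      nlinarith
    have hden : ‖w‖ * ‖1 - l‖ / 2 ≤ ‖(1 - l) * w + (1 + l)‖ := by
      have a1 : ‖1 + l‖ ≤ 2 := (norm_add_le _ _).trans (by rw [norm_one, hl1]; norm_num)
      have := norm_sub_le ((1 - l) * w + (1 + l)) (1 + l)
      rw [add_sub_cancel_right, norm_mul] at this
      linarith [mul_comm ‖w‖ ‖1 - l‖]
    have hK₁b : ‖K₁ w‖ ≤ 8 / ‖1 - l‖ := by
      rw [le_div_iff₀ hd]
      have h3 : ‖K₁ w‖ * (‖w‖ * ‖1 - l‖ / 2) ≤ 4 * ‖w‖ :=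
        (mul_le_mul_of_nonneg_left hden (norm_nonneg _)).trans (by rw [← norm_mul, e]; exact hnum)
      have hw0 : 0 < ‖w‖ := by linarith
      by_contra! h4
      nlinarith [mul_lt_mul_of_pos_right h4 hw0]
    rw [hKK₁]
    refine (norm_add_le _ _).trans ?_
    rw [norm_mul, norm_mul, Complex.norm_I, mul_one, Complex.norm_real, Complex.norm_real,
      Real.norm_eq_abs, Real.norm_eq_abs, abs_of_pos hcre]
    gcongr
  have hGk : ∀ k, K (G^[k] 1) = G^[k] (K 1) := by
    intro k
    induction k with
    | zero => rfl
    | succ k ih =>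
      rw [Function.iterate_succ_apply', Function.iterate_succ_apply',
        hcomm _ (hGm.iterate k one_mem), ih]
  have hsub : ∀ w ∈ rhp, ({w} : Set ℂ) ⊆ rhp := fun w hw => singleton_subset_iff.mpr hw
  have t1 := affine_iterate_tendsto ha hb.ge hab (hsub 1 one_mem) isCompact_singleton
    (max 1 (4 / ‖1 - l‖))
  have t2 := affine_iterate_tendsto ha hb.ge hab (hsub _ (hKm one_mem)) isCompact_singleton
    (c.re * (8 / ‖1 - l‖) + |c.im| + 1)
  obtain ⟨k, hk1, hk2⟩ := (t1.and t2).exists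
  have h5 := hbound _ (hGm.iterate k one_mem) (hk1 1 rfl)
  have h6 := hk2 (K 1) rfl
  rw [hGk] at h5
  linarith

/-- A map that commutes on `U` with a bijection `G` for which `U` is forward invariant extends to
the union of the preimages of `U` under the iterates of `G`. -/
theorem exists_commuting_extension {U : Set ℂ} (hU : IsOpen U) {G Gi H : ℂ → ℂ}
    (hG : Differentiable ℂ G) (hGi : Differentiable ℂ Gi) (hGGi : Function.RightInverse Gi G)
    (hGiG : Function.LeftInverse Gi G) (hGU : MapsTo G U U) (hH : DifferentiableOn ℂ H U)
    (hcomm : ∀ w ∈ U, H (G w) = G (H w)) :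
    ∃ E : ℂ → ℂ, DifferentiableOn ℂ E {w | ∃ k, G^[k] w ∈ U} ∧
      ∀ k w, G^[k] w ∈ U → G^[k] (E w) = H (G^[k] w) := by
  classical
  have hck : ∀ j, ∀ w ∈ U, H (G^[j] w) = G^[j] (H w) := by
    intro j w hw
    induction j with
    | zero => rfl
    | succ j ih =>
      rw [Function.iterate_succ_apply', Function.iterate_succ_apply',
        hcomm _ (hGU.iterate j hw), ih]
  -- Commutation makes the value independent of the admissible index, so the least one may be used;
  -- differentiability uses a fixed `k`, which stays admissible near `w`.
  let E : ℂ → ℂ := fun w =>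
    if h : ∃ k, G^[k] w ∈ U then Gi^[Nat.find h] (H (G^[Nat.find h] w)) else 0
  have key : ∀ k w, G^[k] w ∈ U → G^[k] (E w) = H (G^[k] w) := by
    intro k w hk
    have h : ∃ k, G^[k] w ∈ U := ⟨k, hk⟩
    obtain ⟨j, rfl⟩ := Nat.exists_eq_add_of_le' (Nat.find_min' h hk)
    simp only [E, dif_pos h]
    rw [Function.iterate_add_apply, hGGi.iterate (Nat.find h), Function.iterate_add_apply,
      hck _ _ (Nat.find_spec h)]
  refine ⟨E, ?_, key⟩
  rintro w ⟨k, hk⟩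
  apply DifferentiableAt.differentiableWithinAt
  have hGk : Differentiable ℂ G^[k] := hG.iterate k
  have hev : E =ᶠ[𝓝 w] fun w => Gi^[k] (H (G^[k] w)) := by
    filter_upwards [(hU.preimage hGk.continuous).mem_nhds hk] with v hv
    rw [← key k v hv, hGiG.iterate k]
  refine DifferentiableAt.congr_of_eventuallyEq ?_ hev
  have h1 : DifferentiableAt ℂ H (G^[k] w) := (hH _ hk).differentiableAt (hU.mem_nhds hk)
  exact ((hGi.iterate k) _).comp w (h1.comp w (hGk w))

/-- A holomorphic iterative root of an affine self-map of the half-plane without fixed points is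
affine. -/
theorem exists_affine_of_root {H : ℂ → ℂ} (hH : DifferentiableOn ℂ H rhp)
    (hHm : MapsTo H rhp rhp) {n : ℕ} (hn : 1 ≤ n) {a : ℝ} {b : ℂ} (ha : 1 ≤ a) (hb : 0 ≤ b.re)
    (hab : a = 1 → b ≠ 0) (hroot : ∀ w ∈ rhp, H^[n] w = a * w + b) :
    ∃ p q : ℂ, ∀ w ∈ rhp, H w = p * w + q := by
  have ha0 : 0 < a := by linarith
  have haC : (a : ℂ) ≠ 0 := by exact_mod_cast ha0.ne'
  set G : ℂ → ℂ := fun w => a * w + b with hG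
  have hGm : MapsTo G rhp rhp := affine_mapsTo_rhp ha0 hb
  have hcomm : ∀ w ∈ rhp, H (G w) = G (H w) := by
    intro w hw
    have h1 := hroot (H w) (hHm hw)
    rw [← Function.iterate_succ_apply, Function.iterate_succ_apply', hroot w hw] at h1
    exact h1
  have hGiG : Function.LeftInverse (fun w => (w - b) / a) G :=
    fun w => by simp only [hG]; field_simp; ring
  obtain ⟨E, hEd, hE⟩ := exists_commuting_extension isOpen_rhp (G := G)
    (Gi := fun w => (w - b) / a) (by fun_prop) (by fun_prop)
    (fun w => by simp only [hG]; field_simp; ring) hGiG hGm hH hcomm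
  have hEH : ∀ w ∈ rhp, E w = H w := fun w hw => hE 0 w hw
  have hEn : ∀ m k w, G^[k] w ∈ rhp → G^[k] (E^[m] w) = H^[m] (G^[k] w) := by
    intro m k w hw
    induction m with
    | zero => rfl
    | succ m ih =>
      -- The same `k` serves for `E^[m] w`, because `G^[k] (E^[m] w) = H^[m] (G^[k] w)` lies in the
      -- half-plane.
      rw [Function.iterate_succ_apply', Function.iterate_succ_apply', ← ih, hE]
      rw [ih]
      exact hHm.iterate m hw
  have hEroot : ∀ k w, G^[k] w ∈ rhp → E^[n] w = a * w + b := by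
    intro k w hw
    have h1 := hEn n k w hw
    rw [hroot _ hw] at h1
    apply hGiG.injective.iterate k
    rw [h1]
    change G (G^[k] w) = G^[k] (G w)
    rw [← Function.iterate_succ_apply' G, Function.iterate_succ_apply]
  suffices ∃ p q : ℂ, ∀ w ∈ rhp, E w = p * w + q by
    obtain ⟨p, q, h⟩ := this
    exact ⟨p, q, fun w hw => by rw [← hEH w hw, h w hw]⟩
  by_cases hcase : a = 1 ∧ 0 < b.re
  · obtain ⟨rfl, hb0⟩ := hcase
    have hre : ∀ k w, (G^[k] w).re = w.re + k * b.re := by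
      intro k w
      rw [hG, affine_iterate]
      simp [mul_comm]
    -- This index exceeds `‖w‖ / b.re`, enough translations to reach the half-plane; it costs at
    -- most `‖w‖ + b.re` in real part.
    have hex : ∀ w : ℂ, G^[⌊‖w‖ / b.re⌋₊ + 1] w ∈ rhp := by
      intro w
      change 0 < (G^[_] w).re
      rw [hre]
      have h1 := Nat.lt_floor_add_one (‖w‖ / b.re)
      rw [div_lt_iff₀ hb0] at h1
      have h2 := (abs_le.mp (Complex.abs_re_le_norm w)).1
      push_cast
      linarith
    obtain ⟨p, q, h⟩ := affine_of_re_ge (F := E)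
      (fun w => (hEd w ⟨_, hex w⟩).differentiableAt
        (Filter.mem_of_superset univ_mem fun v _ => ⟨_, hex v⟩)) (C := b.re) (fun w => by
      have h1 := hE _ w (hex w)
      have h2 : 0 < (G^[⌊‖w‖ / b.re⌋₊ + 1] (E w)).re := by rw [h1]; exact hHm (hex w)
      rw [hre] at h2
      have h3 := Nat.floor_le (div_nonneg (norm_nonneg w) hb0.le)
      rw [le_div_iff₀ hb0] at h3
      push_cast at h2
      linarith)
    exact ⟨p, q, fun w _ => h w⟩
  -- `G` preserves the line `Re w = -x` and scales the distance to it by `a`; the translation by `x`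
  -- removes the real part of `b`.
  obtain ⟨x, hx0, hxb, hx1⟩ : ∃ x : ℝ, 0 ≤ x ∧ b.re = x * (a - 1) ∧ (a = 1 → x = 0) := by
    rcases ha.eq_or_lt with h1 | h1
    · refine ⟨0, le_rfl, ?_, fun _ => rfl⟩
      have : ¬ 0 < b.re := fun h => hcase ⟨h1.symm, h⟩
      rw [zero_mul]; linarith
    · have h2 : 0 < a - 1 := by linarith
      exact ⟨b.re / (a - 1), div_nonneg hb h2.le, by field_simp, fun h => absurd h h1.ne'⟩
  have hre : ∀ k w, (G^[k] w).re + x = a ^ k * (w.re + x) := by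
    intro k w
    induction k with
    | zero => simp
    | succ k ih =>
      rw [Function.iterate_succ_apply', pow_succ, mul_right_comm, ← ih]
      simp only [hG, Complex.add_re, Complex.re_ofReal_mul, hxb]
      ring
  have hreach : ∀ w : ℂ, 0 < w.re + x → ∃ k, G^[k] w ∈ rhp := by
    intro w hw
    rcases ha.eq_or_lt with h1 | h1
    · exact ⟨0, by have := hx1 h1.symm; rw [this, add_zero] at hw; exact hw⟩
    · obtain ⟨k, hk⟩ := (((tendsto_pow_atTop_atTop_of_one_lt h1).atTop_mul_const
        hw).eventually_gt_atTop x).exists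
      refine ⟨k, ?_⟩
      rw [← hre] at hk
      change 0 < (G^[k] w).re
      linarith
  have hshift : ∀ w ∈ rhp, 0 < (w - x).re + x := by
    intro w hw
    have h : 0 < w.re := hw
    simpa using h
  have hEpos : ∀ w : ℂ, 0 < w.re + x → 0 < (E w).re + x := by
    intro w hw
    obtain ⟨k, hk⟩ := hreach w hw
    have h1 : 0 < (G^[k] (E w)).re := by rw [hE k w hk]; exact hHm hk
    have h2 := hre k (E w)
    by_contra! h3
    have : a ^ k * ((E w).re + x) ≤ 0 := mul_nonpos_of_nonneg_of_nonpos (by positivity) h3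
    linarith
  have hit : ∀ m (w : ℂ), (fun w => E (w - x) + x)^[m] w = E^[m] (w - x) + x := by
    intro m w
    induction m with
    | zero => simp
    | succ m ih => rw [Function.iterate_succ_apply', Function.iterate_succ_apply', ih]; simp
  obtain ⟨p, q, h⟩ := exists_affine_of_root_of_automorphism (K := fun w => E (w - x) + x)
    (n := n) (a := a) (b := b.im * Complex.I)
    ((hEd.comp (t := {w | ∃ k, G^[k] w ∈ rhp}) (f := fun w : ℂ => w - x) (s := rhp)
      (by fun_prop) (fun w hw => hreach _ (hshift w hw))).add_const _)
    (fun w hw => by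
      have := hEpos _ (hshift w hw)
      change 0 < (E (w - x) + x).re
      simpa using this) hn ha (by simp)
    (fun h1 h2 => by
      apply hab h1
      have hr : b.re = 0 := by rw [hxb, h1]; ring
      apply Complex.ext
      · simpa using hr
      · simpa using h2)
    (fun w hw => by
      obtain ⟨k, hk⟩ := hreach _ (hshift w hw)
      rw [hit, hEroot k _ hk]
      nth_rw 1 [← Complex.re_add_im b]
      rw [hxb]
      push_cast
      ring)
  refine ⟨p, p * x + q - x, fun w hw => ?_⟩
  have hw' : 0 < w.re := hw
  have := h (w + x) (by change 0 < (w + x).re; simp; linarith)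
  simp only [add_sub_cancel_right] at this
  linear_combination this

/-! ### Denjoy-Wolff point and angular derivative of a conjugated affine map. -/

theorem cayleyInv_sub {p w : ℂ} (hw : w ∈ rhp) : cayleyInv p w - p = -(2 * p) / (w + 1) := by
  have := one_add_ne_zero_of_mem_rhp hw
  unfold cayleyInv
  field_simp
  ring

theorem norm_cayleyInv_sub {p w : ℂ} (hp : ‖p‖ = 1) (hw : w ∈ rhp) :
    ‖cayleyInv p w - p‖ = 2 / ‖w + 1‖ := by
  rw [cayleyInv_sub hw, norm_div, norm_neg, norm_mul, hp]
  simp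

theorem iterate_conj_cayley {p : ℂ} (hp : ‖p‖ = 1) {f G : ℂ → ℂ} (hG : MapsTo G rhp rhp)
    (hf : ∀ z ∈ disk, f z = cayleyInv p (G (cayley p z))) (k : ℕ) {z : ℂ} (hz : z ∈ disk) :
    f^[k] z = cayleyInv p (G^[k] (cayley p z)) := by
  induction k with
  | zero => exact (cayleyInv_cayley hp hz).symm
  | succ k ih =>
    have h1 : G^[k] (cayley p z) ∈ rhp := hG.iterate k (cayley_mem_rhp hp hz)
    rw [Function.iterate_succ_apply', Function.iterate_succ_apply', ih,
      hf _ (cayleyInv_mem_disk hp h1), cayley_cayleyInv hp h1]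

theorem iterate_conj_cayleyInv {p : ℂ} (hp : ‖p‖ = 1) {h : ℂ → ℂ} (hh : MapsTo h disk disk)
    (k : ℕ) {w : ℂ} (hw : w ∈ rhp) :
    (fun w => cayley p (h (cayleyInv p w)))^[k] w = cayley p (h^[k] (cayleyInv p w)) := by
  induction k with
  | zero => exact (cayley_cayleyInv hp hw).symm
  | succ k ih =>
    rw [Function.iterate_succ_apply', Function.iterate_succ_apply', ih,
      cayleyInv_cayley hp (hh.iterate k (cayleyInv_mem_disk hp hw))]

theorem isSelfMap_of_affine_conj {p : ℂ} (hp : ‖p‖ = 1) {f : ℂ → ℂ} {a : ℝ} {b : ℂ} (ha : 0 < a)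
    (hb : 0 ≤ b.re) (hf : ∀ z ∈ disk, f z = cayleyInv p (a * cayley p z + b)) : IsSelfMap f := by
  have hG := affine_mapsTo_rhp ha hb
  have hc : MapsTo (cayley p) disk rhp := fun z hz => cayley_mem_rhp hp hz
  constructor
  · refine DifferentiableOn.congr ?_ hf
    exact (differentiableOn_cayleyInv p).comp (((differentiableOn_cayley hp).const_mul _).add_const _)
      (hG.comp hc)
  · intro z hz
    rw [hf z hz]
    exact cayleyInv_mem_disk hp (hG (hc hz))

theorem isDenjoyWolffPoint_of_affine_conj {p : ℂ} (hp : ‖p‖ = 1) {f : ℂ → ℂ} {a : ℝ} {b : ℂ}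
    (ha : 1 ≤ a) (hb : 0 ≤ b.re) (hab : a = 1 → b ≠ 0)
    (hf : ∀ z ∈ disk, f z = cayleyInv p (a * cayley p z + b)) : IsDenjoyWolffPoint f p := by
  have ha0 : 0 < a := by linarith
  have hG := affine_mapsTo_rhp ha0 hb
  have hfix : ∀ z ∈ disk, f z ≠ z := by
    intro z hz h
    rw [hf z hz] at h
    have hw := cayley_mem_rhp hp hz
    have h1 := cayley_cayleyInv hp (hG hw)
    simp only [h] at h1
    set w := cayley p z
    have hre : w.re = a * w.re + b.re := by
      have := congrArg Complex.re h1
      simpa using this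
    have hw' : 0 < w.re := hw
    have ha1 : a = 1 := by nlinarith
    apply hab ha1
    rw [ha1] at h1
    simpa using h1
  have h0 : (0 : ℂ) ∈ disk := by simp [disk]
  refine ⟨fun h => hfix 0 h0 (h h0), Or.inr ⟨hp, hfix, fun K hK hKc => ?_⟩⟩
  rw [Metric.tendstoUniformlyOn_iff]
  intro ε hε
  have hc : MapsTo (cayley p) disk rhp := fun z hz => cayley_mem_rhp hp hz
  have hK' : cayley p '' K ⊆ rhp := (hc.mono_left hK).image_subset
  have hKc' : IsCompact (cayley p '' K) :=
    hKc.image_of_continuousOn ((differentiableOn_cayley hp).continuousOn.mono hK)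
  -- The bound `2 / ε + 2` gives `‖w + 1‖ > 2 / ε`, hence distance `2 / ‖w + 1‖ < ε` from `p`.
  filter_upwards [affine_iterate_tendsto ha hb hab hK' hKc' (2 / ε + 2)] with k hk z hz
  have hw := hk _ (mem_image_of_mem _ hz)
  have hm := hG.iterate k (hc (hK hz))
  rw [iterate_conj_cayley hp hG hf k (hK hz), dist_comm, dist_eq_norm, norm_cayleyInv_sub hp hm]
  set w := (fun w : ℂ => (a : ℂ) * w + b)^[k] (cayley p z)
  have h2 : ‖w‖ ≤ ‖w + 1‖ + 1 := by simpa using norm_sub_le (w + 1) 1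
  have h3 : 2 / ε < ‖w + 1‖ := by linarith
  have h4 : 0 < 2 / ε := by positivity
  rw [div_lt_iff₀ (h4.trans h3)]
  rw [div_lt_iff₀ hε] at h3
  linarith

theorem hasAngularDeriv_of_affine_conj {p : ℂ} (hp : ‖p‖ = 1) {f : ℂ → ℂ} {a : ℝ} {b : ℂ}
    (ha : 0 < a) (hb : 0 ≤ b.re)
    (hf : ∀ z ∈ disk, f z = cayleyInv p (a * cayley p z + b)) :
    HasAngularDeriv f p ((1 / a : ℝ) : ℂ) := by
  have hp0 : p ≠ 0 := by rintro rfl; simp at hp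
  have haC : (a : ℂ) ≠ 0 := by exact_mod_cast ha.ne'
  -- This is the difference quotient at `p` with the pole of the Cayley transform cleared, so it is
  -- continuous at `p`.
  set r : ℂ → ℂ := fun z => 2 * p / (a * (p + z) + (b + 1) * (p - z)) with hr
  have hrt : Tendsto r (𝓝 p) (𝓝 ((1 / a : ℝ) : ℂ)) := by
    have hd : a * (p + p) + (b + 1) * (p - p) ≠ 0 := by
      rw [sub_self, mul_zero, add_zero, ← two_mul]
      exact mul_ne_zero haC (mul_ne_zero two_ne_zero hp0)
    have hcont : ContinuousAt r p := ContinuousAt.div (by fun_prop) (by fun_prop) hd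
    have e : r p = ((1 / a : ℝ) : ℂ) := by
      simp only [hr, sub_self, mul_zero, add_zero]
      push_cast
      field_simp
      ring
    exact e ▸ hcont
  have hdiff : ∀ z ∈ disk, f z - p = r z * (z - p) := by
    intro z hz
    have h1 := sub_ne_zero_of_mem_disk hp hz
    have hm := affine_mapsTo_rhp ha hb (cayley_mem_rhp hp hz)
    have hm1 := one_add_ne_zero_of_mem_rhp hm
    have e : a * cayley p z + b + 1 = (a * (p + z) + (b + 1) * (p - z)) / (p - z) := by
      unfold cayley
      field_simp
      ring
    simp only at hm1
    rw [e, div_ne_zero_iff] at hm1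
    rw [hf z hz, cayleyInv_sub hm, e]
    simp only [hr]
    have := hm1.1
    field_simp
    ring
  have hev : ∀ M, ∀ᶠ z in 𝓝[stolz p M] p, z ∈ disk := fun M => by
    filter_upwards [self_mem_nhdsWithin] with z hz using hz.1
  refine ⟨p, hp, fun M _ => ?_, fun M _ => ?_⟩
  · have h1 : Tendsto (fun z => r z * (z - p) + p) (𝓝 p) (𝓝 (((1 / a : ℝ) : ℂ) * (p - p) + p)) :=
      (hrt.mul ((continuous_id.sub continuous_const).tendsto p)).add_const p
    rw [sub_self, mul_zero, zero_add] at h1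
    refine (h1.mono_left nhdsWithin_le_nhds).congr' ?_
    filter_upwards [hev M] with z hz
    rw [← hdiff z hz, sub_add_cancel]
  · refine (hrt.mono_left nhdsWithin_le_nhds).congr' ?_
    filter_upwards [hev M] with z hz
    have : z - p ≠ 0 := sub_ne_zero.mpr (sub_ne_zero.mp (sub_ne_zero_of_mem_disk hp hz)).symm
    rw [hdiff z hz, mul_div_cancel_right₀ _ this]

/-- The radius ending at `p` lies in the region. Without this, angular limits need not be unique. -/
theorem nhdsWithin_stolz_neBot {p : ℂ} (hp : ‖p‖ = 1) : (𝓝[stolz p 2] p).NeBot := by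
  rw [← mem_closure_iff_nhdsWithin_neBot]
  have ht : Tendsto (fun t : ℝ => (t : ℂ) * p) (𝓝[<] 1) (𝓝 p) := by
    have : Continuous fun t : ℝ => (t : ℂ) * p := by fun_prop
    have h := this.tendsto 1
    rw [Complex.ofReal_one, one_mul] at h
    exact h.mono_left nhdsWithin_le_nhds
  refine mem_closure_of_tendsto ht ?_
  filter_upwards [Ioo_mem_nhdsLT (zero_lt_one (α := ℝ))] with t ht
  have e : (t : ℂ) * p - p = ((t - 1 : ℝ) : ℂ) * p := by push_cast; ring
  have e1 : ‖(t : ℂ) * p‖ = t := by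
    rw [norm_mul, hp, mul_one, Complex.norm_real, Real.norm_eq_abs, abs_of_pos ht.1]
  refine ⟨?_, ?_⟩
  · simp only [disk, Metric.mem_ball, dist_zero_right, e1]
    exact ht.2
  · rw [e, e1, norm_mul, hp, mul_one, Complex.norm_real, Real.norm_eq_abs,
      abs_of_neg (by linarith [ht.2])]
    linarith [ht.2]

theorem HasAngularLimit.unique {p q q' : ℂ} (hp : ‖p‖ = 1) {f : ℂ → ℂ}
    (h : HasAngularLimit f p q) (h' : HasAngularLimit f p q') : q = q' := by
  have := nhdsWithin_stolz_neBot hp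
  exact tendsto_nhds_unique (h 2 one_lt_two) (h' 2 one_lt_two)

theorem HasAngularDeriv.unique {p c c' : ℂ} (hp : ‖p‖ = 1) {f : ℂ → ℂ}
    (h : HasAngularDeriv f p c) (h' : HasAngularDeriv f p c') : c = c' := by
  obtain ⟨q, -, hq, hd⟩ := h
  obtain ⟨q', -, hq', hd'⟩ := h'
  obtain rfl := hq.unique hp hq'
  exact hd.unique hp hd'

theorem IsDenjoyWolffPoint.boundary {p : ℂ} (hp : ‖p‖ = 1) {f : ℂ → ℂ}
    (h : IsDenjoyWolffPoint f p) : (∀ z ∈ disk, f z ≠ z) ∧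
      Tendsto (fun k : ℕ => f^[k] 0) atTop (𝓝 p) := by
  rcases h.2 with h1 | ⟨-, h1, h2⟩
  · exact absurd h1.1 (by simp [disk, hp])
  · refine ⟨h1, (h2 {0} (by simp [disk]) isCompact_singleton).tendsto_at rfl⟩

theorem IsDenjoyWolffPoint.unique {p τ : ℂ} (hp : ‖p‖ = 1) {f : ℂ → ℂ}
    (h : IsDenjoyWolffPoint f p) (h' : IsDenjoyWolffPoint f τ) : τ = p := by
  obtain ⟨h1, h2⟩ := h.boundary hp
  rcases h'.2 with h3 | ⟨h3, -, -⟩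
  · exact absurd h3.2 (h1 _ h3.1)
  · exact tendsto_nhds_unique (h'.boundary h3).2 h2

/-! ### From linear fractional maps to affine maps. -/

/-- A linear fractional self-map of the disk with Denjoy-Wolff point on the circle is conjugate to
an affine self-map of the half-plane. -/
theorem exists_affine_conj {p : ℂ} (hp : ‖p‖ = 1) {φ : ℂ → ℂ} (hlft : IsLFT φ)
    (hself : IsSelfMap φ) (hdw : IsDenjoyWolffPoint φ p) :
    ∃ (a : ℝ) (b : ℂ), 1 ≤ a ∧ 0 ≤ b.re ∧ (a = 1 → b ≠ 0) ∧
      ∀ w ∈ rhp, cayley p (φ (cayleyInv p w)) = a * w + b := by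
  have hp0 : p ≠ 0 := by rintro rfl; simp at hp
  obtain ⟨hfix, hlim⟩ := hdw.boundary hp
  obtain ⟨a, b, c, d, hdet, hφ⟩ := hlft
  have h0 : (0 : ℂ) ∈ disk := by simp [disk]
  have hit : ∀ k, φ^[k] 0 ∈ disk := fun k => hself.2.iterate k h0
  -- Passing to the limit along the orbit of `0` rules out a pole at `p`: there the numerator would
  -- vanish too, against the determinant condition.
  have hle : ‖a * p + b‖ ≤ ‖c * p + d‖ := by
    have hn : ∀ s t : ℂ, Tendsto (fun k : ℕ => ‖s * φ^[k] 0 + t‖) atTop (𝓝 ‖s * p + t‖) :=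
      fun s t => ((hlim.const_mul s).add_const t).norm
    refine le_of_tendsto_of_tendsto' (hn a b) (hn c d) fun k => ?_
    obtain ⟨h1, h2⟩ := hφ _ (hit k)
    have h3 : ‖φ (φ^[k] 0)‖ < 1 := by simpa [disk] using hself.2 (hit k)
    rw [h2, norm_div, div_lt_one (norm_pos_iff.mpr h1)] at h3
    exact h3.le
  have hD : c * p + d ≠ 0 := by
    intro h1
    rw [h1, norm_zero] at hle
    have h2 : a * p + b = 0 := norm_le_zero_iff.mp hle
    apply hdet
    linear_combination a * h1 - c * h2
  have hpp : a * p + b = p * (c * p + d) := by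
    have h1 : Tendsto (fun k : ℕ => φ^[k + 1] 0) atTop (𝓝 ((a * p + b) / (c * p + d))) := by
      refine (((hlim.const_mul a).add_const b).div ((hlim.const_mul c).add_const d) hD).congr
        fun k => ?_
      rw [Function.iterate_succ_apply', (hφ _ (hit k)).2]
      rfl
    have h2 := tendsto_nhds_unique h1 ((tendsto_add_atTop_iff_nat 1).mpr hlim)
    rwa [div_eq_iff hD] at h2
  set E : ℂ := p * (d - c * p) - (b - a * p) with hE
  have hform : ∀ w ∈ rhp, E ≠ 0 ∧ cayley p (φ (cayleyInv p w)) =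
      2 * p * (c * p + d) / E * w + (p * (d - c * p) + b - a * p) / E := by
    intro w hw
    have hz := cayleyInv_mem_disk hp hw
    obtain ⟨h1, h2⟩ := hφ _ hz
    have h3 := sub_ne_zero_of_mem_disk hp (hself.2 hz)
    have hw1 := one_add_ne_zero_of_mem_rhp hw
    rw [eq_div_iff h1] at h2
    have hu : cayleyInv p w * (w + 1) = p * (w - 1) := by
      unfold cayleyInv
      field_simp
    have e1 : (p - φ (cayleyInv p w)) * ((c * cayleyInv p w + d) * (w + 1)) = E := by
      rw [hE]
      linear_combination (-(w + 1)) * h2 + (p * c - a) * hu - w * hpp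
    have e2 : (p + φ (cayleyInv p w)) * ((c * cayleyInv p w + d) * (w + 1)) =
        2 * p * (c * p + d) * w + (p * (d - c * p) + b - a * p) := by
      linear_combination (w + 1) * h2 + (p * c + a) * hu + w * hpp
    have h4 : (c * cayleyInv p w + d) * (w + 1) ≠ 0 := mul_ne_zero h1 hw1
    refine ⟨e1 ▸ mul_ne_zero h3 h4, ?_⟩
    rw [div_mul_eq_mul_div, ← add_div, ← e1, ← e2]
    unfold cayley
    rw [mul_div_mul_right _ _ h4]
  have one_mem : (1 : ℂ) ∈ rhp := by simp [rhp]
  have hE0 := (hform 1 one_mem).1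
  set A : ℂ := 2 * p * (c * p + d) / E
  set B : ℂ := (p * (d - c * p) + b - a * p) / E
  have hA0 : A ≠ 0 := div_ne_zero (mul_ne_zero (mul_ne_zero two_ne_zero hp0) hD) hE0
  obtain ⟨him, hre, hBre⟩ := im_eq_zero_of_affine_mapsTo (a := A) (b := B) (fun w hw => by
    rw [← (hform w hw).2]
    exact cayley_mem_rhp hp (hself.2 (cayleyInv_mem_disk hp hw)))
  have hAr : A = (A.re : ℂ) := Complex.ext rfl (by simpa using him)
  have hconj : ∀ w ∈ rhp, cayley p (φ (cayleyInv p w)) = A.re * w + B := fun w hw => by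
    rw [(hform w hw).2, ← hAr]
  have hconj' : ∀ z ∈ disk, φ z = cayleyInv p (A.re * cayley p z + B) := fun z hz => by
    rw [← hconj _ (cayley_mem_rhp hp hz), cayleyInv_cayley hp hz,
      cayleyInv_cayley hp (hself.2 hz)]
  have hApos : 0 < A.re := lt_of_le_of_ne hre fun h => hA0 (by rw [hAr, ← h, Complex.ofReal_zero])
  have hGm := affine_mapsTo_rhp hApos hBre
  refine ⟨A.re, B, ?_, hBre, ?_, hconj⟩
  -- With slope below `1` the ball of radius `R` is mapped into itself where the orbit of `1` runs,
  -- which keeps the orbit of `0` in the disk away from `p`.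
  · by_contra! hlt
    have h1A : 0 < 1 - A.re := by linarith
    set R : ℝ := 1 + ‖B‖ / (1 - A.re) with hR
    have hB : ‖B‖ ≤ (1 - A.re) * R := by
      rw [hR, mul_add, mul_div_cancel₀ _ h1A.ne']
      linarith
    have hbound : ∀ k, ‖(fun w : ℂ => (A.re : ℂ) * w + B)^[k] 1‖ ≤ R := by
      intro k
      induction k with
      | zero =>
        have : 0 ≤ ‖B‖ / (1 - A.re) := by positivity
        simp only [Function.iterate_zero, id_eq, norm_one, hR]
        linarith
      | succ k ih =>
        rw [Function.iterate_succ_apply']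
        refine (norm_add_le _ _).trans ?_
        rw [norm_mul, Complex.norm_real, Real.norm_eq_abs, abs_of_pos hApos]
        nlinarith
    have hc0 : cayley p 0 = 1 := by simp [cayley, hp0]
    have h1 : Tendsto (fun k : ℕ => ‖φ^[k] 0 - p‖) atTop (𝓝 0) := by
      simpa using (hlim.sub_const p).norm
    have hR0 : 0 ≤ R := (norm_nonneg _).trans (hbound 0)
    have h2 : 2 / (R + 1) ≤ 0 := by
      refine ge_of_tendsto' h1 fun k => ?_
      have hm := hGm.iterate k one_mem
      rw [iterate_conj_cayley hp hGm hconj' k h0, hc0, norm_cayleyInv_sub hp hm]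
      have hpos := norm_pos_iff.mpr (one_add_ne_zero_of_mem_rhp hm)
      gcongr
      refine (norm_add_le _ _).trans ?_
      rw [norm_one]
      linarith [hbound k]
    have h3 : 0 < 2 / (R + 1) := by positivity
    linarith
  · intro h1 hB0
    apply hfix 0 h0
    rw [hconj' 0 h0, h1, hB0, Complex.ofReal_one, one_mul, add_zero, cayleyInv_cayley hp h0]

/-! ### The explicit root and its uniqueness. -/

theorem sum_pow_ofReal_ne_zero {α : ℝ} (hα : 0 < α) {n : ℕ} (hn : 1 ≤ n) :
    ∑ k ∈ Finset.range n, (α : ℂ) ^ k ≠ 0 := by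
  have h : 0 < ∑ k ∈ Finset.range n, α ^ k :=
    Finset.sum_pos (fun _ _ => by positivity) (Finset.nonempty_range_iff.mpr (by omega))
  exact_mod_cast h.ne'

theorem existsUnique_pos_root {A : ℝ} (hA : 0 < A) {n : ℕ} (hn : 1 ≤ n) :
    ∃! α : ℝ, 0 < α ∧ α ^ n = A := by
  have hn0 : n ≠ 0 := by omega
  refine ⟨A ^ (1 / n : ℝ), ⟨Real.rpow_pos_of_pos hA _, ?_⟩, fun y hy => ?_⟩
  · rw [one_div, Real.rpow_inv_natCast_pow hA.le hn0]
  · rw [one_div, ← hy.2, Real.pow_rpow_inv_natCast hy.1.le hn0]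

theorem affine_iterate_root {α A : ℝ} {B : ℂ} {n : ℕ} (hn : 1 ≤ n) (hα : 0 < α)
    (hαA : α ^ n = A) (w : ℂ) :
    (fun w => (α : ℂ) * w + B / ∑ k ∈ Finset.range n, (α : ℂ) ^ k)^[n] w = A * w + B := by
  rw [affine_iterate, div_mul_cancel₀ _ (sum_pow_ofReal_ne_zero hα hn), ← hαA]
  push_cast
  rfl

/-- The only holomorphic `n`-th root of `w ↦ A * w + B` on the half-plane. -/
theorem root_eq {H : ℂ → ℂ} (hH : DifferentiableOn ℂ H rhp) (hHm : MapsTo H rhp rhp) {n : ℕ}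
    (hn : 1 ≤ n) {A α : ℝ} {B : ℂ} (hA : 1 ≤ A) (hB : 0 ≤ B.re) (hAB : A = 1 → B ≠ 0)
    (hα : 0 < α) (hαA : α ^ n = A) (hroot : ∀ w ∈ rhp, H^[n] w = A * w + B) :
    ∀ w ∈ rhp, H w = α * w + B / ∑ k ∈ Finset.range n, (α : ℂ) ^ k := by
  obtain ⟨p, q, h⟩ := exists_affine_of_root hH hHm hn hA hB hAB hroot
  have hit : ∀ k, ∀ w ∈ rhp, H^[k] w = (fun w => p * w + q)^[k] w := by
    intro k w hw
    induction k with
    | zero => rfl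
    | succ k ih =>
      rw [Function.iterate_succ_apply', Function.iterate_succ_apply', ← ih,
        h _ (hHm.iterate k hw)]
  have hpoly : ∀ w ∈ rhp, p ^ n * w + q * ∑ j ∈ Finset.range n, p ^ j = A * w + B := by
    intro w hw
    rw [← affine_iterate, ← hit n w hw, hroot w hw]
  have h1 := hpoly 1 (by simp [rhp])
  have h2 := hpoly 2 (by simp [rhp])
  have hpA : p ^ n = A := by linear_combination h2 - h1
  -- Preserving the half-plane forces `p` to be real and nonnegative, which selects `α` among the
  -- complex `n`-th roots of `A`.
  obtain ⟨him, hre, -⟩ := im_eq_zero_of_affine_mapsTo (a := p) (b := q) (fun w hw => by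
    rw [← h w hw]
    exact hHm hw)
  have hpr : p = (p.re : ℂ) := Complex.ext rfl (by simpa using him)
  have hpα : p.re = α := by
    rw [hpr, ← hαA] at hpA
    exact (pow_left_inj₀ hre hα.le (Nat.one_le_iff_ne_zero.mp hn)).mp (by exact_mod_cast hpA)
  rw [hpα] at hpr
  subst hpr
  have hq : q * ∑ j ∈ Finset.range n, (α : ℂ) ^ j = B := by linear_combination h1 - hpA
  intro w hw
  rw [h w hw, ← hq, mul_div_cancel_right₀ _ (sum_pow_ofReal_ne_zero hα hn)]

end DiskMaps

theorem mainTheorem7 (n : ℕ) (hn : 1 ≤ n) (φ : ℂ → ℂ)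
    (hlft : DiskMaps.IsLFT φ) (hself : DiskMaps.IsSelfMap φ)
    (htype : DiskMaps.IsParabolic φ ∨ DiskMaps.IsHyperbolic φ) :
    ∃ f : ℂ → ℂ,
      -- existence and uniqueness (as functions on the disk)
      DiskMaps.IsRoot n φ f ∧
      (∀ h : ℂ → ℂ, DiskMaps.IsRoot n φ h → EqOn h f DiskMaps.disk) ∧
      -- the type is preserved
      (DiskMaps.IsParabolic φ → DiskMaps.IsParabolic f) ∧
      (DiskMaps.IsHyperbolic φ → DiskMaps.IsHyperbolic f) ∧
      -- the formula
      ∀ τ : ℂ, DiskMaps.IsDenjoyWolffPoint φ τ →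
        ∃ (A : ℝ) (B : ℂ), 1 ≤ A ∧ 0 ≤ B.re ∧
          (∀ w : ℂ, 0 < w.re →
            DiskMaps.cayley τ (φ (DiskMaps.cayleyInv τ w)) = (A : ℂ) * w + B) ∧
          (∃! α : ℝ, 0 < α ∧ α ^ n = A) ∧
          ∀ α : ℝ, 0 < α → α ^ n = A →
            ∀ g : ℂ → ℂ,
              (∀ w : ℂ, g w = (α : ℂ) * w + B / ∑ k ∈ Finset.range n, (α : ℂ) ^ k) →
              ∀ z ∈ DiskMaps.disk,
                f z = DiskMaps.cayleyInv τ (g (DiskMaps.cayley τ z)) ∧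
                f z = τ * ((g ((τ + z) / (τ - z)) - 1) / (g ((τ + z) / (τ - z)) + 1)) := by
  obtain ⟨p, hp, hdw⟩ : ∃ p : ℂ, ‖p‖ = 1 ∧ DiskMaps.IsDenjoyWolffPoint φ p := by
    rcases htype with ⟨p, hp, hdw, -⟩ | ⟨p, hp, hdw, -⟩ <;> exact ⟨p, hp, hdw⟩
  obtain ⟨A, B, hA, hB, hAB, hconj⟩ := DiskMaps.exists_affine_conj hp hlft hself hdw
  have hA0 : 0 < A := by linarith
  have hroot := DiskMaps.existsUnique_pos_root hA0 hn
  obtain ⟨α, ⟨hα, hαA⟩, -⟩ := id hroot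
  -- Needed so that `f` has the same Denjoy-Wolff point `p` as `φ`.
  have hα1 : 1 ≤ α := (one_le_pow_iff_of_nonneg hα.le (by omega)).mp (hαA ▸ hA)
  set S : ℂ := ∑ k ∈ Finset.range n, (α : ℂ) ^ k with hS
  have hS0 : S ≠ 0 := DiskMaps.sum_pow_ofReal_ne_zero hα hn
  set β : ℂ := B / S with hβ
  have hβre : 0 ≤ β.re := by
    have e : S = ((∑ k ∈ Finset.range n, α ^ k : ℝ) : ℂ) := by rw [hS]; push_cast; rfl
    rw [hβ, e, Complex.div_ofReal_re]
    exact div_nonneg hB (Finset.sum_nonneg fun _ _ => by positivity)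
  have hαβ : α = 1 → β ≠ 0 := fun h => div_ne_zero (hAB (by rw [← hαA, h, one_pow])) hS0
  have hφ : ∀ z ∈ DiskMaps.disk, φ z = DiskMaps.cayleyInv p (A * DiskMaps.cayley p z + B) := by
    intro z hz
    rw [← hconj _ (DiskMaps.cayley_mem_rhp hp hz), DiskMaps.cayleyInv_cayley hp hz,
      DiskMaps.cayleyInv_cayley hp (hself.2 hz)]
  set f : ℂ → ℂ := fun z => DiskMaps.cayleyInv p (α * DiskMaps.cayley p z + β) with hf
  have hff : ∀ z ∈ DiskMaps.disk, f z = DiskMaps.cayleyInv p (α * DiskMaps.cayley p z + β) :=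
    fun _ _ => rfl
  have hdwf := DiskMaps.isDenjoyWolffPoint_of_affine_conj hp hα1 hβre hαβ hff
  have hderf := DiskMaps.hasAngularDeriv_of_affine_conj hp hα hβre hff
  have hderφ := DiskMaps.hasAngularDeriv_of_affine_conj hp hA0 hB hφ
  refine ⟨f, ⟨DiskMaps.isSelfMap_of_affine_conj hp hα hβre hff, fun z hz => ?_⟩,
    fun h hh z hz => ?_, ?_, ?_, fun τ hτ => ?_⟩
  · rw [DiskMaps.iterate_conj_cayley hp (DiskMaps.affine_mapsTo_rhp hα hβre) hff n hz,
      DiskMaps.affine_iterate_root hn hα hαA, hφ z hz]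
  · obtain ⟨⟨hhd, hhm⟩, hhr⟩ := hh
    have hci : MapsTo (DiskMaps.cayleyInv p) DiskMaps.rhp DiskMaps.disk :=
      fun w hw => DiskMaps.cayleyInv_mem_disk hp hw
    have hw := DiskMaps.cayley_mem_rhp hp hz
    have := DiskMaps.root_eq (H := fun w => DiskMaps.cayley p (h (DiskMaps.cayleyInv p w)))
      ((DiskMaps.differentiableOn_cayley hp).comp
        (hhd.comp (DiskMaps.differentiableOn_cayleyInv p) hci) (hhm.comp hci))
      (fun w hw => DiskMaps.cayley_mem_rhp hp (hhm (hci hw))) hn hA hB hAB hα hαA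
      (fun w hw => by
        rw [DiskMaps.iterate_conj_cayleyInv hp hhm n hw, hhr (hci hw), hconj w hw]) _ hw
    simp only [DiskMaps.cayleyInv_cayley hp hz] at this
    rw [hff z hz, hβ, hS, ← this, DiskMaps.cayleyInv_cayley hp (hhm hz)]
  · rintro ⟨p', hp', hdw', hd'⟩
    obtain rfl := hdw.unique hp hdw'
    -- Uniqueness of the angular derivative lets the type of `φ` be read off from `A`.
    have h1 : 1 / A = 1 := by exact_mod_cast hderφ.unique hp hd'
    have hA1 : A = 1 := by
      rw [div_eq_one_iff_eq hA0.ne'] at h1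
      exact h1.symm
    have hα1 : α = 1 := (pow_eq_one_iff_of_nonneg hα.le (by omega)).mp (hαA.trans hA1)
    refine ⟨p', hp, hdwf, ?_⟩
    rw [hα1] at hderf
    simpa using hderf
  · rintro ⟨p', hp', hdw', c, hc, hd'⟩
    obtain rfl := hdw.unique hp hdw'
    have h1 : 1 / A = c := by exact_mod_cast hderφ.unique hp hd'
    refine ⟨p', hp, hdwf, 1 / α, ?_, hderf⟩
    rw [← h1, div_lt_one hA0, ← hαA] at hc
    rw [div_lt_one hα]
    exact (one_lt_pow_iff_of_nonneg hα.le (by omega)).mp hc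
  · obtain rfl := hdw.unique hp hτ
    refine ⟨A, B, hA, hB, hconj, hroot, fun α' hα' hαA' g hg z hz => ?_⟩
    obtain rfl : α' = α := hroot.unique ⟨hα', hαA'⟩ ⟨hα, hαA⟩
    have h1 : f z = DiskMaps.cayleyInv τ (g (DiskMaps.cayley τ z)) := by rw [hg]
    exact ⟨h1, h1⟩
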